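/- **Theorem (Joint Uniqueness in Law).** Let $U$ be a separable real Banach space and $H$ a real Hilbert space with dense continuous embeddings $U\hookrightarrow H\hookrightarrow U'$, where $H$ is identified with its dual, so that $h\in H$ is the functional $v\mapsto (h,v)_H$ on $U$. Write $(f,v)=f(v)$ for $f\in U'$, $v\in U$. Let $T>0$, $1<r<\infty$, let $A:U\to U'$ be Borel measurable, and put $$\mathbb X_1=C([0,T];U')\cap L^r(0,T;U)_{weak},$$ where $C([0,T];U')$ has the uniform topology, $L^r(0,T;U)_{weak}$ is $L^r(0,T;U)$ with its weak topology, and $\mathbb X_1$ has the coarsest topology making both inclusions continuous; topological spaces carry their Borel $\sigma$-algebras. Assume that the deterministic equation has unique solutions in the following sense: whenever $\lambda>0$ and $u_1,u_2\in\mathbb X_1$ satisfy $A(u_1),A(u_2)\in L^1(0,T;U')$ and $$(u_2(t)-u_1(t),v)+\int_0^t\lambda\,\bigl(A(u_2(s))-A(u_1(s)),v\bigr)\,ds=0\qquad\text{for all }t\in[0,T],\ v\in U,$$ then $u_1=u_2$. A pair $(u,V)$ of random variables on a probability space $(\Omega,\mathcal F,\mathbb P)$ with values in $\mathbb X_1\times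 C([0,T];U')$ is said to satisfy $du=dV-A(u)\,dt$ if $\mathbb P[u\in S]=1$ for some $\sigma$-compact set $S\subset\mathbb X_1$, $A(u)\in L^1(0,T;U')$ almost surely, and for every $t\in[0,T]$ and $v\in U$ $$\mathbb P\Bigl[(u(t),v)=(V(t),v)-\int_0^t(A(u(s)),v)\,ds\Bigr]=1.$$ If, for $i=0,1$, the pair $(u^i,V^i)$ satisfies $du=dV-A(u)\,dt$ on a probability space $(\Omega^i,\mathcal F^i,\mathbb P^i)$, and if $\mathcal L(V^0)=\mathcal L(V^1)$ on $C([0,T];U')$, then $\mathcal L(u^0,V^0)=\mathcal L(u^1,V^1)$ on $\mathbb X_1\times C([0,T];U')$. -/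

import Mathlib

open MeasureTheory Set TopologicalSpace
open scoped ENNReal

noncomputable section

variable {U H : Type*} [NormedAddCommGroup U] [NormedSpace ℝ U]
  [NormedAddCommGroup H] [InnerProductSpace ℝ H]

/-- For a continuous linear map `ι : U → H` into a real Hilbert space, the induced map `H → U'`
which sends `h` to the functional `v ↦ (h, ι v)_H`. -/
def pivotMap (ι : U →L[ℝ] H) (h : H) : StrongDual ℝ U :=
  (innerSL ℝ h).comp ι

/-- `U ↪ H ↪ U'` are dense (continuous, injective) embeddings; `H` is identified with its dual.
The map `H → U'` is automatically continuous, and it is injective because `ι` has dense range. -/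
structure IsGelfandTriple (ι : U →L[ℝ] H) : Prop where
  injective : Function.Injective ι
  denseRange : DenseRange ι
  denseRange_pivot : DenseRange (pivotMap ι)

/-- `C[0,T;U']` with the topology of uniform convergence (`U'` carries the dual norm). -/
abbrev DualPath (U : Type*) [NormedAddCommGroup U] [NormedSpace ℝ U] (T : ℝ) : Type _ :=
  C(Icc (0 : ℝ) T, StrongDual ℝ U)

/-- `C[0,T;U']` carries its Borel σ-algebra. -/
instance DualPath.instMeasurableSpace (T : ℝ) : MeasurableSpace (DualPath U T) :=
  borel _

instance DualPath.instBorelSpace (T : ℝ) : BorelSpace (DualPath U T) :=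
  ⟨rfl⟩

/-- Lebesgue measure on `[0,T]`. -/
def timeMeasure (T : ℝ) : Measure (Icc (0 : ℝ) T) :=
  Measure.comap Subtype.val volume

/-- `L^r[0,T;U]`, the Bochner space with respect to Lebesgue measure on `[0,T]`. -/
abbrev BochnerPath (U : Type*) [NormedAddCommGroup U] (T : ℝ) (r : ℝ≥0∞) : Type _ :=
  Lp U r (timeMeasure T)

/-- The space `C[0,T;U'] ∩ L^r[0,T;U]_weak`. An element consists of a continuous `U'`-valued path
`w` and a class `g ∈ L^r[0,T;U]` with `w(t) = g(t)` in `U'` for almost every `t`; as `U → U'` is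
injective in a Gelfand triple, each of `w` and `g` then determines the other. -/
def SolSpace (ι : U →L[ℝ] H) (T : ℝ) (r : ℝ≥0∞) [Fact (1 ≤ r)] : Type _ :=
  {p : DualPath U T × WeakSpace ℝ (BochnerPath U T r) //
    ∀ᵐ t ∂(timeMeasure T),
      p.1 t = pivotMap ι (ι (((toWeakSpace ℝ (BochnerPath U T r)).symm p.2) t))}

namespace SolSpace

variable {ι : U →L[ℝ] H} {T : ℝ} {r : ℝ≥0∞} [Fact (1 ≤ r)]

/-- The intersection topology: the coarsest one for which the inclusions into `C[0,T;U']` and into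
`L^r[0,T;U]` with its weak topology are continuous. -/
instance instTopologicalSpace : TopologicalSpace (SolSpace ι T r) :=
  TopologicalSpace.induced Subtype.val inferInstance

/-- `C[0,T;U'] ∩ L^r[0,T;U]_weak` carries its Borel σ-algebra. -/
instance instMeasurableSpace : MeasurableSpace (SolSpace ι T r) :=
  borel _

instance instBorelSpace : BorelSpace (SolSpace ι T r) :=
  ⟨rfl⟩

/-- The continuous `U'`-valued path `t ↦ u(t)`. -/
def path (u : SolSpace ι T r) : DualPath U T :=
  u.1.1

/-- The element `u` of `L^r[0,T;U]`. -/
def toLp (u : SolSpace ι T r) : BochnerPath U T r :=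
  (toWeakSpace ℝ (BochnerPath U T r)).symm u.1.2

/-- In a Gelfand triple with `U` separable, the product σ-algebra on
`(C[0,T;U'] ∩ L^r[0,T;U]_weak) × C[0,T;U']` is the Borel σ-algebra of the product space. Hence
there is only one notion of the joint law of a pair of random variables. -/
theorem borelSpace_prod [SeparableSpace U] (hι : IsGelfandTriple ι) :
    BorelSpace (SolSpace ι T r × DualPath U T) := by
  have hcont : Continuous (pivotMap ι) :=
    ((ContinuousLinearMap.compL ℝ U H ℝ).flip ι).continuous.comp (innerSL ℝ (E := H)).continuous
  have hd : DenseRange (pivotMap ι ∘ ι) := hι.denseRange_pivot.comp hι.denseRange hcont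
  have : SeparableSpace (StrongDual ℝ U) := hd.separableSpace (hcont.comp ι.continuous)
  have : SecondCountableTopology (StrongDual ℝ U) :=
    UniformSpace.secondCountable_of_separable _
  infer_instance

end SolSpace

/-- Uniqueness for the deterministic equation: if `λ > 0`, if `u₁, u₂ ∈ C[0,T;U'] ∩ L^r[0,T;U]`,
if `A(u₁), A(u₂) ∈ L¹[0,T;U']`, and if
`(u₂(t) - u₁(t), v) + ∫₀ᵗ λ (A(u₂(s)) - A(u₁(s)), v) ds = 0` for all `t ∈ [0,T]`, `v ∈ U`,
then `u₁ = u₂`. -/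
def DeterministicUniqueness (ι : U →L[ℝ] H) (T : ℝ) (r : ℝ≥0∞) [Fact (1 ≤ r)]
    (A : U → StrongDual ℝ U) : Prop :=
  ∀ (l : ℝ) (u₁ u₂ : SolSpace ι T r), 0 < l →
    Integrable (fun s => A (u₁.toLp s)) (timeMeasure T) →
    Integrable (fun s => A (u₂.toLp s)) (timeMeasure T) →
    (∀ (t : Icc (0 : ℝ) T) (v : U),
      (u₂.path t - u₁.path t) v
        + ∫ s in Iic t, l * (A (u₂.toLp s) - A (u₁.toLp s)) v ∂(timeMeasure T) = 0) →
    u₁ = u₂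

/-- The pair of random variables `(u, V)`, with values in
`(C[0,T;U'] ∩ L^r[0,T;U]_weak) × C[0,T;U']`, satisfies `du = dV - A(u) dt` on the probability
space `(Ω, P)`. -/
structure IsSolution {ι : U →L[ℝ] H} {T : ℝ} {r : ℝ≥0∞} [Fact (1 ≤ r)]
    (A : U → StrongDual ℝ U) {Ω : Type*} [MeasurableSpace Ω] (P : Measure Ω)
    (u : Ω → SolSpace ι T r) (V : Ω → DualPath U T) : Prop where
  measurable_left : Measurable u
  measurable_right : Measurable V
  sigmaCompact : ∃ S : Set (SolSpace ι T r), IsSigmaCompact S ∧ ∀ᵐ ω ∂P, u ω ∈ S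
  integrable : ∀ᵐ ω ∂P, Integrable (fun s => A ((u ω).toLp s)) (timeMeasure T)
  equation : ∀ (t : Icc (0 : ℝ) T) (v : U), ∀ᵐ ω ∂P,
    (u ω).path t v = V ω t v - ∫ s in Iic t, A ((u ω).toLp s) v ∂(timeMeasure T)

end

/-!
The equation determines the noise from the solution: almost surely `V(t) = u(t) + ∫₀ᵗ A(u(s)) ds`
for all `t` at once, since both sides are continuous in `t` and linear continuous in the test vector,
so that countably many instances of the equation imply all of them. Deterministic uniqueness with
`λ = 1` says conversely that `V` determines `u`: on the set `G` of all pairs `(u, V)` with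
`A(u) ∈ L¹` that solve the equation, the projection `(u, V) ↦ V` is injective
(`DeterministicUniqueness.injOn_snd`). If `G` is a Borel set in a standard Borel space, the
Lusin-Souslin theorem makes the projection of `B ∩ G` a Borel set for every Borel set `B`; by
injectivity, `P[(u, V) ∈ B] = P[V ∈ snd (B ∩ G)]`, so the law of `V` fixes the joint law
(`map_prodMk_eq_of_injOn_snd`).

Two points remain. The space `C[0,T;U'] ∩ L^r[0,T;U]_weak` is not obviously standard Borel, but its
Borel σ-algebra is the one induced from `C[0,T;U'] × L^r[0,T;U]` with the *norm* topology, which is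
Polish (`SolSpace.measurableSpace_eq_comap_toProd`): weakly open sets are norm open, and on a
separable Banach space the norm is a countable supremum of functionals, so that weak measurability
implies norm measurability (`measurable_of_measurable_dual`). The law of `(u, V)` is
therefore determined by its image in that Polish product.

Secondly, `G` is Borel (`measurableSet_solutionGraph`). For Borel `F`, the integral `∫ F(g(s)) ds`
over a subset of `[0,T]` is the integral of `F` against an occupation measure of `g`, and the
occupation measure depends measurably on `g ∈ L^r` (`measurable_map_Lp`).
-/

/-! ### Measurability and laws -/

section General

open Filter Topology

/-- A weakly measurable map into a separable normed space is measurable: a closed ball is an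
intersection of countably many half-spaces, defined by functionals which norm a dense sequence. -/
theorem measurable_of_measurable_dual {Ω E : Type*} [MeasurableSpace Ω]
    [NormedAddCommGroup E] [NormedSpace ℝ E] [SeparableSpace E]
    [MeasurableSpace E] [BorelSpace E] {f : Ω → E}
    (hf : ∀ φ : StrongDual ℝ E, Measurable fun ω => φ (f ω)) : Measurable f := by
  have : SecondCountableTopology E := UniformSpace.secondCountable_of_separable _
  -- Functionals of norm at most one that norm the points of a dense sequence.
  choose φ hφ₁ hφ₂ using fun n : ℕ => exists_dual_vector'' ℝ (denseSeq E n)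
  have key : ∀ (x : E) (ρ : ℝ), (∀ n, φ n x ≤ ρ) → ‖x‖ ≤ ρ := by
    intro x ρ h
    refine le_of_forall_pos_le_add fun ε hε => ?_
    obtain ⟨n, hn⟩ := (denseRange_denseSeq E).exists_dist_lt x (half_pos hε)
    rw [dist_eq_norm] at hn
    have h1 : ‖x‖ ≤ ‖x - denseSeq E n‖ + ‖denseSeq E n‖ := by
      simpa using norm_add_le (x - denseSeq E n) (denseSeq E n)
    have h2 : φ n (denseSeq E n) = ‖denseSeq E n‖ := by simpa using hφ₂ n
    have h3 : |φ n (x - denseSeq E n)| ≤ ‖x - denseSeq E n‖ := by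
      simpa using (φ n).le_of_opNorm_le (hφ₁ n) (x - denseSeq E n)
    have h4 := neg_le_of_abs_le h3
    rw [map_sub] at h4
    linarith [h n]
  have hball : ∀ (c : E) (ρ : ℝ), MeasurableSet (f ⁻¹' Metric.closedBall c ρ) := by
    intro c ρ
    have : f ⁻¹' Metric.closedBall c ρ = ⋂ n, {ω | φ n (f ω) ≤ φ n c + ρ} := by
      ext ω
      simp only [mem_preimage, mem_closedBall_iff_norm, mem_iInter, mem_ofPred_eq]
      constructor
      · intro h n
        have h3 : |φ n (f ω - c)| ≤ ‖f ω - c‖ := by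
          simpa using (φ n).le_of_opNorm_le (hφ₁ n) (f ω - c)
        have h4 := le_of_abs_le h3
        rw [map_sub] at h4
        linarith
      · intro h
        refine key _ _ fun n => ?_
        rw [map_sub]
        linarith [h n]
    rw [this]
    exact MeasurableSet.iInter fun n => measurableSet_le (hf _) measurable_const
  -- By the Lindelöf property, open sets are countable unions of closed balls.
  refine measurable_of_isOpen fun s hs => ?_
  choose! ρ hρ hρs using fun x (hx : x ∈ s) =>
    Metric.nhds_basis_closedBall.mem_iff.1 (hs.mem_nhds hx)
  obtain ⟨t, ht, htc, htu⟩ := countable_cover_nhdsWithin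
    (f := fun x => Metric.closedBall x (ρ x)) (s := s)
    (fun x hx => mem_nhdsWithin_of_mem_nhds (Metric.closedBall_mem_nhds x (hρ x hx)))
  have : s = ⋃ x ∈ t, Metric.closedBall x (ρ x) :=
    Subset.antisymm htu (iUnion₂_subset fun x hx => hρs x (ht hx))
  rw [this, preimage_iUnion₂]
  exact MeasurableSet.biUnion htc fun x _ => hball _ _

/-- The occupation measure `ν.map g` depends measurably on `g ∈ L^p(μ)`. For an open set `O`, the mass
`ν (g ⁻¹' O)` is lower semicontinuous in `g`, by Fatou's lemma along an almost everywhere convergent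
subsequence. -/
theorem measurable_map_Lp {X E : Type*} [MeasurableSpace X] [NormedAddCommGroup E]
    [MeasurableSpace E] [BorelSpace E] {p : ℝ≥0∞} [Fact (1 ≤ p)] {μ ν : Measure X}
    [IsFiniteMeasure ν] (hν : ν ≪ μ) [MeasurableSpace (Lp E p μ)] [OpensMeasurableSpace (Lp E p μ)] :
    Measurable fun g : Lp E p μ => ν.map g := by
  have hm : ∀ g : Lp E p μ, AEMeasurable g ν := fun g =>
    (Lp.aestronglyMeasurable g).aemeasurable.mono_ac hν
  have hopen : ∀ O : Set E, IsOpen O → Measurable fun g : Lp E p μ => ν.map g O := by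
    intro O hO
    refine measurable_of_Iic fun c => IsClosed.measurableSet ?_
    refine IsSeqClosed.isClosed fun g g₀ hg hlim => ?_
    simp only [mem_preimage, mem_Iic] at hg ⊢
    obtain ⟨k, -, hk⟩ := (tendstoInMeasure_of_tendsto_Lp hlim).exists_seq_tendsto_ae
    have hk' := hν.ae_le hk
    rw [Measure.map_apply_of_aemeasurable (hm g₀) hO.measurableSet]
    simp_rw [Measure.map_apply_of_aemeasurable (hm _) hO.measurableSet] at hg
    have hset : ∀ g : Lp E p μ, ν (g ⁻¹' O) = ∫⁻ x, (O.indicator 1 (g x) : ℝ≥0∞) ∂ν := by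
      intro g
      have h0 : NullMeasurableSet (g ⁻¹' O) ν := (hm g).nullMeasurable hO.measurableSet
      rw [← lintegral_indicator_one₀ h0]
      rfl
    simp_rw [hset] at hg ⊢
    calc ∫⁻ x, (O.indicator 1 (g₀ x) : ℝ≥0∞) ∂ν
        ≤ ∫⁻ x, liminf (fun n => (O.indicator 1 (g (k n) x) : ℝ≥0∞)) atTop ∂ν := by
          refine lintegral_mono_ae ?_
          filter_upwards [hk'] with x hx
          by_cases hxO : g₀ x ∈ O
          · refine le_liminf_of_le (by isBoundedDefault) ?_
            filter_upwards [hx.eventually (hO.mem_nhds hxO)] with n hn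
            rw [indicator_of_mem hxO, indicator_of_mem hn]
            exact le_rfl
          · simp [hxO]
      _ ≤ liminf (fun n => ∫⁻ x, (O.indicator 1 (g (k n) x) : ℝ≥0∞) ∂ν) atTop := by
          refine lintegral_liminf_le' fun n => ?_
          exact (measurable_one.indicator hO.measurableSet).comp_aemeasurable (hm _)
      _ ≤ c := liminf_le_of_le (by isBoundedDefault) fun b hb => by
          obtain ⟨n, hn⟩ := hb.exists
          exact hn.trans (hg _)
  have : ∀ g : Lp E p μ, IsFiniteMeasure (ν.map g) := fun g => inferInstance
  exact Measurable.measure_of_isPiSystem (BorelSpace.measurable_eq (α := E)) isPiSystem_isOpen hopen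
    (hopen univ isOpen_univ)

theorem continuous_setIntegral_Iic {X E : Type*} [TopologicalSpace X] [LinearOrder X]
    [OrderTopology X] [FirstCountableTopology X] [MeasurableSpace X] [OpensMeasurableSpace X]
    [NormedAddCommGroup E] [NormedSpace ℝ E] {μ : Measure X} [NullSingletonClass μ] {f : X → E}
    (hf : Integrable f μ) : Continuous fun t => ∫ s in Iic t, f s ∂μ := by
  simp_rw [← integral_indicator measurableSet_Iic]
  refine continuous_iff_continuousAt.2 fun t => ?_
  refine continuousAt_of_dominated (bound := fun s => ‖f s‖) ?_ ?_ hf.norm ?_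
  · exact .of_forall fun t => hf.aestronglyMeasurable.indicator measurableSet_Iic
  · exact .of_forall fun t => .of_forall fun s => norm_indicator_le_norm_self _ _
  · have : ∀ᵐ s ∂μ, s ≠ t := by simp [ae_iff]
    filter_upwards [this] with s hs
    -- For `s ≠ t`, the value at `s` of the indicator of `Iic t'` is constant for `t'` near `t`.
    rcases hs.lt_or_gt with h | h
    · refine continuousAt_const.congr (f := fun _ => f s) ?_
      filter_upwards [Ioi_mem_nhds h] with t' ht'
      rw [indicator_of_mem (mem_Iic.2 (le_of_lt ht'))]
    · refine continuousAt_const.congr (f := fun _ => (0 : E)) ?_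
      filter_upwards [Iio_mem_nhds h] with t' ht'
      rw [indicator_of_notMem (notMem_Iic.2 ht')]

/-- If `(x₀, y₀)` and `(x₁, y₁)` take values in a measurable set on which the second coordinate
determines the first, then the law of the second coordinate determines the joint law. This is where
the Lusin-Souslin theorem enters. -/
theorem map_prodMk_eq_of_injOn_snd {X Y Ω₀ Ω₁ : Type*} [MeasurableSpace X] [StandardBorelSpace X]
    [MeasurableSpace Y] [StandardBorelSpace Y] [MeasurableSpace Ω₀] [MeasurableSpace Ω₁]
    {P₀ : Measure Ω₀} {P₁ : Measure Ω₁} {x₀ : Ω₀ → X} {y₀ : Ω₀ → Y} {x₁ : Ω₁ → X} {y₁ : Ω₁ → Y}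
    (hx₀ : Measurable x₀) (hy₀ : Measurable y₀) (hx₁ : Measurable x₁) (hy₁ : Measurable y₁)
    {G : Set (X × Y)} (hG : MeasurableSet G) (hinj : InjOn Prod.snd G)
    (hG₀ : ∀ᵐ ω ∂P₀, (x₀ ω, y₀ ω) ∈ G) (hG₁ : ∀ᵐ ω ∂P₁, (x₁ ω, y₁ ω) ∈ G)
    (hy : P₀.map y₀ = P₁.map y₁) :
    P₀.map (fun ω => (x₀ ω, y₀ ω)) = P₁.map (fun ω => (x₁ ω, y₁ ω)) := by
  ext B hB
  have hB' : MeasurableSet (Prod.snd '' (B ∩ G)) :=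
    (hB.inter hG).image_of_measurable_injOn measurable_snd (hinj.mono inter_subset_right)
  have key : ∀ z ∈ G, (z ∈ B ↔ z.2 ∈ Prod.snd '' (B ∩ G)) := by
    refine fun z hz => ⟨fun hzB => ⟨z, ⟨hzB, hz⟩, rfl⟩, ?_⟩
    rintro ⟨z', ⟨hz'B, hz'G⟩, h⟩
    rwa [← hinj hz'G hz h]
  rw [Measure.map_apply (hx₀.prodMk hy₀) hB, Measure.map_apply (hx₁.prodMk hy₁) hB]
  calc P₀ ((fun ω => (x₀ ω, y₀ ω)) ⁻¹' B)
      = P₀ (y₀ ⁻¹' (Prod.snd '' (B ∩ G))) :=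
        measure_congr (by filter_upwards [hG₀] with ω hω using propext (key _ hω))
    _ = P₁ (y₁ ⁻¹' (Prod.snd '' (B ∩ G))) := by
        rw [← Measure.map_apply hy₀ hB', hy, Measure.map_apply hy₁ hB']
    _ = P₁ ((fun ω => (x₁ ω, y₁ ω)) ⁻¹' B) :=
        (measure_congr (by filter_upwards [hG₁] with ω hω using propext (key _ hω))).symm

end General

/-! ### The Gelfand triple and the path spaces -/

noncomputable section

variable {U H : Type*} [NormedAddCommGroup U] [NormedSpace ℝ U]
  [NormedAddCommGroup H] [InnerProductSpace ℝ H]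

theorem continuous_pivotMap (ι : U →L[ℝ] H) : Continuous (pivotMap ι) :=
  ((ContinuousLinearMap.compL ℝ U H ℝ).flip ι).continuous.comp (innerSL ℝ (E := H)).continuous

/-- The embedding `U → U'` of a Gelfand triple, `u ↦ (v ↦ (ι u, ι v)_H)`, as a continuous linear
map. -/
def pivotCLM (ι : U →L[ℝ] H) : U →L[ℝ] StrongDual ℝ U where
  toFun u := pivotMap ι (ι u)
  map_add' x y := by ext v; simp [pivotMap]
  map_smul' c x := by ext v; simp [pivotMap]
  cont := (continuous_pivotMap ι).comp ι.continuous

theorem IsGelfandTriple.secondCountableTopology_dual [SeparableSpace U] {ι : U →L[ℝ] H}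
    (hι : IsGelfandTriple ι) : SecondCountableTopology (StrongDual ℝ U) := by
  have hd : DenseRange (pivotMap ι ∘ ι) :=
    hι.denseRange_pivot.comp hι.denseRange (continuous_pivotMap ι)
  have : SeparableSpace (StrongDual ℝ U) :=
    hd.separableSpace ((continuous_pivotMap ι).comp ι.continuous)
  exact UniformSpace.secondCountable_of_separable _

instance timeMeasure.instIsFiniteMeasure (T : ℝ) : IsFiniteMeasure (timeMeasure T) where
  measure_univ_lt_top := by
    rw [timeMeasure, comap_subtype_coe_apply measurableSet_Icc, image_univ, Subtype.range_coe]
    exact measure_Icc_lt_top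

instance timeMeasure.instNullSingletonClass (T : ℝ) : NullSingletonClass (timeMeasure T) where
  measure_singleton t := by
    rw [timeMeasure, comap_subtype_coe_apply measurableSet_Icc, image_singleton,
      measure_singleton]

theorem polishSpace_dualPath [SecondCountableTopology (StrongDual ℝ U)] (T : ℝ) :
    PolishSpace (DualPath U T) where
  toSecondCountableTopology := inferInstance
  complete := ⟨inferInstance, rfl, inferInstance⟩

/-- The condition `w(t) = g(t)` in `U'` for almost every `t` is closed in the norm topologies: it
says that `w` and the image of `g` coincide in `L^r[0,T;U']`. -/
theorem isClosed_ae_eq_pivotMap (ι : U →L[ℝ] H) (T : ℝ) (r : ℝ≥0∞) [Fact (1 ≤ r)]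
    [SecondCountableTopology (StrongDual ℝ U)] :
    IsClosed {p : DualPath U T × BochnerPath U T r |
      ∀ᵐ t ∂(timeMeasure T), p.1 t = pivotMap ι (ι (p.2 t))} := by
  have : {p : DualPath U T × BochnerPath U T r |
      ∀ᵐ t ∂(timeMeasure T), p.1 t = pivotMap ι (ι (p.2 t))} =
      {p | ContinuousMap.toLp (E := StrongDual ℝ U) r (timeMeasure T) ℝ p.1
        = (pivotCLM ι).compLpL r (timeMeasure T) p.2} := by
    ext p
    simp only [mem_ofPred_eq]
    have h1 := ContinuousMap.coeFn_toLp (p := r) (𝕜 := ℝ) (timeMeasure T) p.1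
    have h2 := (pivotCLM ι).coeFn_compLpL p.2
    rw [Lp.ext_iff]
    constructor
    · intro h
      filter_upwards [h, h1, h2] with t h h1 h2
      rw [h1, h2, h]
      rfl
    · intro h
      filter_upwards [h, h1, h2] with t h h1 h2
      rw [← h1, h, h2]
      rfl
  rw [this]
  exact isClosed_eq ((ContinuousLinearMap.continuous _).comp continuous_fst)
    ((ContinuousLinearMap.continuous _).comp continuous_snd)

/-- If the equation holds on a dense set of times and test vectors, then it holds for all of them. -/
theorem forall_eq_sub_setIntegral_of_dense {T : ℝ} {w V : DualPath U T}
    {f : Icc (0 : ℝ) T → StrongDual ℝ U} (hf : Integrable f (timeMeasure T))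
    {D : Set (Icc (0 : ℝ) T)} (hD : Dense D) {E : Set U} (hE : Dense E)
    (h : ∀ t ∈ D, ∀ v ∈ E, w t v = V t v - ∫ s in Iic t, f s v ∂(timeMeasure T))
    (t : Icc (0 : ℝ) T) (v : U) :
    w t v = V t v - ∫ s in Iic t, f s v ∂(timeMeasure T) := by
  have key : (fun t => w t) = fun t => V t - ∫ s in Iic t, f s ∂(timeMeasure T) := by
    refine Continuous.ext_on hD w.continuous (V.continuous.sub (continuous_setIntegral_Iic hf))
      fun t ht => DFunLike.coe_injective ?_
    refine Continuous.ext_on hE (ContinuousLinearMap.continuous _)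
      (ContinuousLinearMap.continuous _) fun v hv => ?_
    rw [sub_apply, ContinuousLinearMap.integral_apply hf.integrableOn]
    exact h t ht v hv
  have := congrArg (fun φ : StrongDual ℝ U => φ v) (congrFun key t)
  simp only [sub_apply] at this
  rw [this, ContinuousLinearMap.integral_apply hf.integrableOn]

/-! ### The graph of the equation -/

/-- The triples `((w, g), V)` for which `w` and `g` are the same path, `A(g)` is integrable, and the
equation `w = V - ∫ A(g)` holds at the times in `D` when tested with the vectors in `E`. -/
def solutionGraph (ι : U →L[ℝ] H) (T : ℝ) (r : ℝ≥0∞) (A : U → StrongDual ℝ U)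
    (D : Set (Icc (0 : ℝ) T)) (E : Set U) :
    Set ((DualPath U T × BochnerPath U T r) × DualPath U T) :=
  {z | (∀ᵐ t ∂(timeMeasure T), z.1.1 t = pivotMap ι (ι (z.1.2 t))) ∧
    Integrable (fun s => A (z.1.2 s)) (timeMeasure T) ∧
    ∀ t ∈ D, ∀ v ∈ E,
      z.1.1 t v = z.2 t v - ∫ s in Iic t, A (z.1.2 s) v ∂(timeMeasure T)}

theorem measurableSet_solutionGraph [MeasurableSpace U] [BorelSpace U]
    [SecondCountableTopology (StrongDual ℝ U)] [SeparableSpace U]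
    (ι : U →L[ℝ] H) (T : ℝ) (r : ℝ≥0∞) [Fact (1 ≤ r)] [Fact (r ≠ ∞)]
    [MeasurableSpace (BochnerPath U T r)] [BorelSpace (BochnerPath U T r)]
    {A : U → StrongDual ℝ U} (hA : Measurable A)
    {D : Set (Icc (0 : ℝ) T)} (hD : D.Countable) {E : Set U} (hE : E.Countable) :
    MeasurableSet (solutionGraph ι T r A D E) := by
  -- The occupation measures `g ↦ (dt|[0,t]).map g` form a kernel, which reduces the measurability
  -- of `g ↦ ∫ F(g(s)) ds` to that of integrals against a kernel.
  let κ (t : Set (Icc (0 : ℝ) T)) : ProbabilityTheory.Kernel (BochnerPath U T r) U :=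
    ⟨fun g => ((timeMeasure T).restrict t).map g,
      measurable_map_Lp Measure.restrict_le_self.absolutelyContinuous⟩
  have hm : ∀ (t : Set (Icc (0 : ℝ) T)) (g : BochnerPath U T r),
      AEMeasurable g ((timeMeasure T).restrict t) := fun t g =>
    (Lp.aestronglyMeasurable g).aemeasurable.restrict
  refine MeasurableSet.inter ?_ (MeasurableSet.inter ?_ ?_)
  · exact (isClosed_ae_eq_pivotMap ι T r).measurableSet.preimage measurable_fst
  · have h1 := ProbabilityTheory.measurableSet_integrable (κ := κ univ) hA.stronglyMeasurable
    have h2 : {g : BochnerPath U T r | Integrable (fun s => A (g s)) (timeMeasure T)} =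
        {g | Integrable A (κ univ g)} := by
      ext g
      have := integrable_map_measure (f := g) (μ := (timeMeasure T).restrict univ)
        hA.stronglyMeasurable.aestronglyMeasurable (hm univ g)
      rw [Measure.restrict_univ] at this
      simp only [mem_ofPred_eq]
      refine this.symm.trans ?_
      simp [κ]
    rw [← h2] at h1
    exact h1.preimage (measurable_snd.comp measurable_fst)
  · have : {z : (DualPath U T × BochnerPath U T r) × DualPath U T | ∀ t ∈ D, ∀ v ∈ E,
      z.1.1 t v = z.2 t v - ∫ s in Iic t, A (z.1.2 s) v ∂(timeMeasure T)} =
      ⋂ t ∈ D, ⋂ v ∈ E, {z : (DualPath U T × BochnerPath U T r) × DualPath U T |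
        z.1.1 t v = z.2 t v - ∫ s in Iic t, A (z.1.2 s) v ∂(timeMeasure T)} := by
      ext z; simp
    refine MeasurableSet.congr ?_ this.symm
    refine .biInter hD fun t _ => .biInter hE fun v _ => ?_
    have heval : Continuous fun w : DualPath U T => w t v := by fun_prop
    have hAv : StronglyMeasurable fun x => A x v :=
      ((ContinuousLinearMap.apply ℝ ℝ v).continuous.measurable.comp hA).stronglyMeasurable
    have hint : Measurable fun g : BochnerPath U T r =>
        ∫ s in Iic t, A (g s) v ∂(timeMeasure T) := by
      have h1 := (hAv.integral_kernel (κ := κ (Iic t))).measurable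
      convert h1 using 2 with g
      exact (integral_map (hm _ g) hAv.aestronglyMeasurable).symm
    exact measurableSet_eq_fun (heval.measurable.comp (measurable_fst.comp measurable_fst))
      ((heval.measurable.comp measurable_snd).sub
        (hint.comp (measurable_snd.comp measurable_fst)))

/-- Deterministic uniqueness, used with `λ = 1`: two solutions with the same `V` coincide, as `V`
cancels in the difference of their equations. -/
theorem DeterministicUniqueness.injOn_snd {ι : U →L[ℝ] H} {T : ℝ} {r : ℝ≥0∞} [Fact (1 ≤ r)]
    {A : U → StrongDual ℝ U} (huniq : DeterministicUniqueness ι T r A)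
    {D : Set (Icc (0 : ℝ) T)} (hD : Dense D) {E : Set U} (hE : Dense E) :
    InjOn Prod.snd (solutionGraph ι T r A D E) := by
  rintro ⟨⟨w₁, g₁⟩, V⟩ ⟨hc₁, hi₁, he₁⟩ ⟨⟨w₂, g₂⟩, V'⟩ ⟨hc₂, hi₂, he₂⟩ (rfl : V = V')
  have h := huniq 1 ⟨(w₁, toWeakSpace ℝ _ g₁), hc₁⟩ ⟨(w₂, toWeakSpace ℝ _ g₂), hc₂⟩ one_pos hi₁ hi₂
    fun t v => by
      have h₁ := forall_eq_sub_setIntegral_of_dense hi₁ hD hE he₁ t v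
      have h₂ := forall_eq_sub_setIntegral_of_dense hi₂ hD hE he₂ t v
      have hs : ∫ s in Iic t, 1 * (A (g₂ s) - A (g₁ s)) v ∂(timeMeasure T) =
          ∫ s in Iic t, A (g₂ s) v ∂(timeMeasure T)
            - ∫ s in Iic t, A (g₁ s) v ∂(timeMeasure T) := by
        simp_rw [one_mul, sub_apply]
        exact integral_sub (hi₂.integrableOn.apply_continuousLinearMap v)
          (hi₁.integrableOn.apply_continuousLinearMap v)
      refine (congrArg ((w₂ t - w₁ t) v + ·) hs).trans ?_
      rw [sub_apply, h₁, h₂]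
      ring
  have h' := congrArg Subtype.val h
  rw [Prod.mk.injEq] at h'
  obtain ⟨rfl, h'⟩ := h'
  rw [(toWeakSpace ℝ _).injective h']

/-! ### The Borel σ-algebra of the solution space -/

namespace SolSpace

variable {ι : U →L[ℝ] H} {T : ℝ} {r : ℝ≥0∞} [Fact (1 ≤ r)]

/-- The inclusion of `C[0,T;U'] ∩ L^r[0,T;U]_weak` into `C[0,T;U'] × L^r[0,T;U]`, where now
`L^r[0,T;U]` is meant with its norm topology. It is not continuous in general. -/
def toProd (u : SolSpace ι T r) : DualPath U T × BochnerPath U T r :=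
  (u.path, u.toLp)

/-- Measurability for the norm topology of `L^r`, although `toProd` is continuous only for its weak
topology. -/
theorem measurable_toProd [SeparableSpace U] [Fact (r ≠ ∞)]
    [MeasurableSpace (BochnerPath U T r)] [BorelSpace (BochnerPath U T r)] :
    Measurable (toProd : SolSpace ι T r → _) := by
  have hval : Continuous (fun u : SolSpace ι T r => u.1) := continuous_induced_dom
  refine (continuous_fst.comp hval).measurable.prodMk ?_
  refine measurable_of_measurable_dual fun φ => Continuous.measurable ?_
  exact (WeakBilin.eval_continuous (topDualPairing ℝ _).flip φ).comp (continuous_snd.comp hval)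

/-- The Borel σ-algebra of `C[0,T;U'] ∩ L^r[0,T;U]_weak` is the one which the norm topology of
`L^r[0,T;U]` would induce. -/
theorem measurableSpace_eq_comap_toProd [SeparableSpace U] [Fact (r ≠ ∞)]
    [MeasurableSpace (BochnerPath U T r)] [BorelSpace (BochnerPath U T r)]
    [SecondCountableTopology (StrongDual ℝ U)] :
    (instMeasurableSpace : MeasurableSpace (SolSpace ι T r)) =
      MeasurableSpace.comap toProd inferInstance := by
  refine le_antisymm (MeasurableSpace.generateFrom_le ?_) measurable_toProd.comap_le
  rintro s ⟨O, hO, rfl⟩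
  refine ⟨(fun p : DualPath U T × BochnerPath U T r =>
    (p.1, toWeakSpaceCLM ℝ (BochnerPath U T r) p.2)) ⁻¹' O, IsOpen.measurableSet ?_, rfl⟩
  exact hO.preimage (continuous_fst.prodMk
    ((toWeakSpaceCLM ℝ (BochnerPath U T r)).continuous.comp continuous_snd))

end SolSpace

/-! ### Joint uniqueness in law -/

theorem IsSolution.ae_mem_solutionGraph {ι : U →L[ℝ] H} {T : ℝ} {r : ℝ≥0∞} [Fact (1 ≤ r)]
    {A : U → StrongDual ℝ U} {Ω : Type*} [MeasurableSpace Ω] {P : Measure Ω}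
    {u : Ω → SolSpace ι T r} {V : Ω → DualPath U T} (h : IsSolution A P u V)
    {D : Set (Icc (0 : ℝ) T)} (hD : D.Countable) {E : Set U} (hE : E.Countable) :
    ∀ᵐ ω ∂P, ((u ω).toProd, V ω) ∈ solutionGraph ι T r A D E := by
  have he : ∀ᵐ ω ∂P, ∀ t ∈ D, ∀ v ∈ E, (u ω).path t v =
      V ω t v - ∫ s in Iic t, A ((u ω).toLp s) v ∂(timeMeasure T) :=
    (ae_ball_iff hD).2 fun t _ => (ae_ball_iff hE).2 fun v _ => h.equation t v
  filter_upwards [h.integrable, he] with ω hi he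
  exact ⟨(u ω).2, hi, he⟩

end

theorem mainTheorem6 {U H : Type*}
    [NormedAddCommGroup U] [NormedSpace ℝ U] [CompleteSpace U] [SeparableSpace U]
    [MeasurableSpace U] [BorelSpace U]
    [NormedAddCommGroup H] [InnerProductSpace ℝ H] [CompleteSpace H]
    (ι : U →L[ℝ] H) (hι : IsGelfandTriple ι)
    (T : ℝ) (hT : 0 < T) (r : ℝ≥0∞) [Fact (1 ≤ r)] (hr : 1 < r) (hr' : r < ∞)
    (A : U → StrongDual ℝ U) (hA : Measurable A)
    (huniq : DeterministicUniqueness ι T r A)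
    {Ω₀ Ω₁ : Type*} [MeasurableSpace Ω₀] [MeasurableSpace Ω₁]
    (P₀ : Measure Ω₀) [IsProbabilityMeasure P₀] (P₁ : Measure Ω₁) [IsProbabilityMeasure P₁]
    (u₀ : Ω₀ → SolSpace ι T r) (V₀ : Ω₀ → DualPath U T)
    (u₁ : Ω₁ → SolSpace ι T r) (V₁ : Ω₁ → DualPath U T)
    (h₀ : IsSolution A P₀ u₀ V₀) (h₁ : IsSolution A P₁ u₁ V₁)
    (hV : P₀.map V₀ = P₁.map V₁) :
    P₀.map (fun ω => (u₀ ω, V₀ ω)) = P₁.map (fun ω => (u₁ ω, V₁ ω)) := by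
  have := hι.secondCountableTopology_dual
  have : Fact (r ≠ ∞) := ⟨hr'.ne⟩
  borelize (BochnerPath U T r)
  have := polishSpace_dualPath (U := U) T
  obtain ⟨D, hDc, hD⟩ := exists_countable_dense (Icc (0 : ℝ) T)
  obtain ⟨E, hEc, hE⟩ := exists_countable_dense U
  have hu₀ : Measurable fun ω => (u₀ ω).toProd := SolSpace.measurable_toProd.comp h₀.measurable_left
  have hu₁ : Measurable fun ω => (u₁ ω).toProd := SolSpace.measurable_toProd.comp h₁.measurable_left
  have key : P₀.map (fun ω => ((u₀ ω).toProd, V₀ ω)) = P₁.map (fun ω => ((u₁ ω).toProd, V₁ ω)) :=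
    map_prodMk_eq_of_injOn_snd hu₀ h₀.measurable_right hu₁ h₁.measurable_right
      (measurableSet_solutionGraph ι T r hA hDc hEc) (huniq.injOn_snd hD hE)
      (h₀.ae_mem_solutionGraph hDc hEc) (h₁.ae_mem_solutionGraph hDc hEc) hV
  ext B hB
  -- A Borel set of the solution space comes from a Borel set for the norm topology.
  obtain ⟨B', hB', rfl⟩ : MeasurableSet[MeasurableSpace.comap
      (Prod.map SolSpace.toProd id) inferInstance] B := by
    rwa [Prod.instMeasurableSpace, MeasurableSpace.comap_prodMap, MeasurableSpace.comap_id,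
      ← SolSpace.measurableSpace_eq_comap_toProd]
  have hB'' := congrArg (fun μ => μ B') key
  beta_reduce at hB''
  rw [Measure.map_apply (hu₀.prodMk h₀.measurable_right) hB',
    Measure.map_apply (hu₁.prodMk h₁.measurable_right) hB'] at hB''
  rw [Measure.map_apply (h₀.measurable_left.prodMk h₀.measurable_right) hB,
    Measure.map_apply (h₁.measurable_left.prodMk h₁.measurable_right) hB]
  exact hB''
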